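/- For a finite simple graph $G$ let $\pi(G)$ be the maximum number of edges of a spanning linear forest of $G$, that is, of a spanning subgraph of $G$ that is a forest all of whose components are paths (isolated vertices are allowed as components). For a graph $G$ with vertices $u_1,\dots,u_m$ and graphs $H_1,\dots,H_m$, the generalized lexicographic product $G[H_1,\dots,H_m]$ is obtained from $G$ by replacing each vertex $u_i$ with the graph $H_i$ and adding all edges between $H_i$ and $H_j$ whenever $u_i$ and $u_j$ are adjacent in $G$. A graph is hamiltonian if it contains a hamiltonian cycle, traceable if it contains a hamiltonian path, and hamiltonian connected if every two distinct vertices are the ends of a hamiltonian path. Theorem. Let $k\ge 1$ and $n\ge 1$, let $P_{2k+1}$ be the path with consecutive vertices $u_1,\dots,u_{2k+1}$, and let $H_1,\dots,H_{2k+1}$ be simple graphs with $n$ vertices each. Then the graph $P_{2k+1}[H_1,\dots,H_{2k+1}]$ is (i) hamiltonian if and only if $\pi(H_1)\ge 1$, $\pi(H_{2k+1})\ge 1$ and $\sum_{i=0}^{k}\pi(H_{2i+1})\ge n$; (ii) traceable if and only if $\sum_{i=0}^{k}\pi(H_{2i+1})\ge n-1$; (iii) hamiltonian connected if and only if $\pi(H_1)\ge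 2$, $\pi(H_{2k+1})\ge 2$ and $\sum_{i=0}^{k}\pi(H_{2i+1})\ge n+1$. -/

import Mathlib

namespace SimpleGraph

/-- The generalized lexicographic product: every vertex `i` of `G` is replaced by the graph `H i`,
and all edges between `H i` and `H j` are added whenever `i` and `j` are adjacent in `G`. -/
def genLexProduct {ι : Type*} {V : ι → Type*} (G : SimpleGraph ι)
    (H : ∀ i, SimpleGraph (V i)) : SimpleGraph (Σ i, V i) where
  Adj x y := G.Adj x.1 y.1 ∨ ∃ (i : ι) (u v : V i), (H i).Adj u v ∧ x = ⟨i, u⟩ ∧ y = ⟨i, v⟩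
  symm := ⟨by
    rintro x y (h | ⟨i, u, v, h, hx, hy⟩)
    · exact Or.inl h.symm
    · exact Or.inr ⟨i, v, u, h.symm, hy, hx⟩⟩
  loopless := ⟨by
    rintro x (h | ⟨i, u, v, h, hx, hy⟩)
    · exact h.ne rfl
    · rw [hx] at hy
      cases hy
      exact h.ne rfl⟩

/-- A linear forest: a forest all of whose components are paths (an isolated vertex is a path
with one vertex). -/
def IsLinearForest {V : Type*} (F : SimpleGraph V) : Prop :=
  F.IsAcyclic ∧ ∀ c : F.ConnectedComponent, ∃ m : ℕ, Nonempty (c.toSimpleGraph ≃g pathGraph m)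

/-- `π(G)`: the maximum number of edges of a spanning linear forest of the finite graph `G`.
A spanning subgraph of `G` is a graph `F ≤ G` on the same vertex type. -/
noncomputable def maxLinearForest {V : Type*} (G : SimpleGraph V) : ℕ :=
  sSup {m : ℕ | ∃ F : SimpleGraph V, F ≤ G ∧ F.IsLinearForest ∧ F.edgeSet.ncard = m}

theorem isLinearForest_bot {V : Type*} : (⊥ : SimpleGraph V).IsLinearForest := by
  refine ⟨isAcyclic_bot, fun c => ⟨1, ?_⟩⟩
  induction c using ConnectedComponent.ind with | _ v =>
  have hs : ∀ x : ((⊥ : SimpleGraph V).connectedComponentMk v), x.1 = v := by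
    rintro ⟨x, hx⟩
    have h : (⊥ : SimpleGraph V).Reachable x v := ConnectedComponent.exact hx
    simpa using h
  refine ⟨⟨⟨fun _ => 0, fun _ => ⟨v, rfl⟩, ?_, ?_⟩, ?_⟩⟩
  · intro x
    exact Subtype.ext (hs x).symm
  · intro x
    exact Subsingleton.elim _ _
  · intro a b
    have hab : a = b := Subtype.ext ((hs a).trans (hs b).symm)
    subst hab
    simp

/-- For a finite graph the supremum in `maxLinearForest` is a maximum. -/
theorem isGreatest_maxLinearForest {V : Type*} [Finite V] (G : SimpleGraph V) :
    IsGreatest {m : ℕ | ∃ F : SimpleGraph V, F ≤ G ∧ F.IsLinearForest ∧ F.edgeSet.ncard = m}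
      G.maxLinearForest := by
  have hb : BddAbove
      {m : ℕ | ∃ F : SimpleGraph V, F ≤ G ∧ F.IsLinearForest ∧ F.edgeSet.ncard = m} := by
    refine ⟨G.edgeSet.ncard, ?_⟩
    rintro m ⟨F, hF, -, rfl⟩
    exact Set.ncard_le_ncard (edgeSet_mono hF) (Set.toFinite _)
  exact ⟨Nat.sSup_mem ⟨_, ⊥, bot_le, isLinearForest_bot, rfl⟩ hb, fun m hm => le_csSup hb hm⟩

/-- A graph is traceable if it contains a hamiltonian path. -/
def IsTraceable {V : Type*} [DecidableEq V] (G : SimpleGraph V) : Prop :=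
  ∃ (u v : V) (p : G.Walk u v), p.IsHamiltonian

/-- A graph is hamiltonian connected if every two (distinct) vertices are the ends of a
hamiltonian path. -/
def IsHamiltonianConnected {V : Type*} [DecidableEq V] (G : SimpleGraph V) : Prop :=
  ∀ u v : V, u ≠ v → ∃ p : G.Walk u v, p.IsHamiltonian

end SimpleGraph

namespace SimpleGraph

/-! Number the levels `0, …, 2k`; the sums then run over the even levels.

Necessity is double counting. A step of a hamiltonian path either stays inside an even level or
touches an odd one. Steps inside a level form a linear forest there, and the `k * n` odd vertices
meet at most two steps each, one fewer per end of the path. This gives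
`IsHamiltonianSeq.le_sum_maxLinearForest`. An end level has neighbours only in one level of the same
size, which must also lead onward; `IsHamiltonianSeq.le_maxLinearForest_end` turns this into a lower
bound for its `π`. The three cases differ only in where the ends of the path are put.

For sufficiency, each level splits into `n - π` or more paths, with some freedom in choosing their
first vertices (`exists_heads`). Odd levels are split into single vertices, the even level `2 * j`
into `n - x j` paths. Consecutive levels are completely joined, so any walk on the levels that
visits each one as often as it has paths lifts to a hamiltonian path
(`IsPathPartition.exists_isHamiltonian`). Such a walk is a monotone walk with round trips between
neighbouring levels inserted; the visit numbers determine the round trips, and `hasLevelWalk_of_sum`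
says when this succeeds. -/

/-! ### Linear forests and partitions into paths -/

theorem not_reachable_of_forall_adj {V : Type*} {G : SimpleGraph V} (s : Set V)
    (hs : ∀ x y, G.Adj x y → x ∈ s → y ∈ s) {u v : V} (hu : u ∈ s) (hv : v ∉ s) :
    ¬ G.Reachable u v := by
  rintro ⟨p⟩
  induction p with
  | nil => exact hv hu
  | cons h p ih => exact ih (hs _ _ h hu) hv

theorem exists_adj_of_reachable {V : Type*} {G : SimpleGraph V} (s : Set V)
    {u v : V} (h : G.Reachable u v) (hu : u ∈ s) (hv : v ∉ s) :
    ∃ x y, G.Adj x y ∧ G.Reachable u x ∧ x ∈ s ∧ y ∉ s := by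
  by_contra! hc
  refine not_reachable_of_forall_adj {x | x ∈ s ∧ G.Reachable u x} ?_ ⟨hu, Reachable.refl _⟩
    (fun h' => hv h'.1) h
  rintro x y hxy ⟨hx, hux⟩
  exact ⟨hc x y hxy hux hx, hux.trans hxy.reachable⟩

/-- A finite graph that embeds into a path is a linear forest. -/
theorem isLinearForest_of_injective {V : Type*} [Finite V] (F : SimpleGraph V) (f : V → ℕ)
    (hf : Function.Injective f) (hF : ∀ u v, F.Adj u v → f u + 1 = f v ∨ f v + 1 = f u) :
    F.IsLinearForest := by
  -- The edge `uv` is the only one crossing the cut `f ≤ f u`, so it is a bridge.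
  have key : ∀ u v, F.Adj u v → f u + 1 = f v → ¬ (F.deleteEdges {s(u, v)}).Reachable u v := by
    intro u v huv huv'
    refine not_reachable_of_forall_adj {x | f x ≤ f u} ?_ (by simp) (by simp; omega)
    intro x y hxy hx
    simp only [deleteEdges_adj, Set.mem_singleton_iff, Set.mem_ofPred_eq] at hxy hx ⊢
    by_contra hy
    apply hxy.2
    rcases hF _ _ hxy.1 with h | h
    · have h1 : x = u := hf (by omega)
      have h2 : y = v := hf (by omega)
      rw [h1, h2]
    · omega
  constructor
  · rw [isAcyclic_iff_forall_isBridge]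
    intro e he
    induction e using Sym2.ind with | _ u v =>
    have huv : F.Adj u v := he
    rw [isBridge_iff]
    rcases hF u v huv with h | h
    · exact key u v huv h
    · intro h'
      refine key v u huv.symm h ?_
      rw [Sym2.eq_swap]
      exact h'.symm
  · intro c
    let _ : LinearOrder c := LinearOrder.lift' (fun x : c => f x.1)
      (fun x y h => Subtype.ext (hf h))
    have hlt : ∀ x y : c, x < y ↔ f x.1 < f y.1 := fun x y => Iff.rfl
    have := Fintype.ofFinite c
    refine ⟨Fintype.card c, ⟨?_⟩⟩
    let e : c ≃o Fin (Fintype.card c) := (Fintype.orderIsoFinOfCardEq c rfl).symm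
    refine ⟨e.toEquiv, ?_⟩
    -- Some edge of the component crosses the cut `f ≤ f u`. It joins consecutive values of `f`, and
    -- no vertex of the component lies strictly between `u` and `v`, so it is `uv`.
    have hcov : ∀ u v : c, u ⋖ v → F.Adj u.1 v.1 := by
      intro u v huv
      have h1 := (hlt _ _).1 huv.1
      have hr : F.Reachable u.1 v.1 :=
        ConnectedComponent.exact ((u.2 : F.connectedComponentMk u.1 = c).trans
          (v.2 : F.connectedComponentMk v.1 = c).symm)
      obtain ⟨x, y, hxy, hux, hx, hy⟩ := exists_adj_of_reachable {x | f x ≤ f u.1} hr (by simp)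
        (by simpa using h1)
      simp only [Set.mem_ofPred_eq, not_le] at hx hy
      have hyc : y ∈ c := (ConnectedComponent.sound (hux.trans hxy.reachable).symm).trans u.2
      have h2 := huv.2 (c := ⟨y, hyc⟩) hy
      rw [hlt] at h2
      simp only [not_lt] at h2
      rcases hF _ _ hxy with h | h
      · have hx' : x = u.1 := hf (by omega)
        have hy' : y = v.1 := hf (by omega)
        rwa [hx', hy'] at hxy
      · omega
    have hcov' : ∀ u v : c, f u.1 + 1 = f v.1 → u ⋖ v := by
      intro u v h
      refine ⟨(hlt _ _).2 (by omega), fun w h1 h2 => ?_⟩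
      rw [hlt] at h1 h2
      omega
    intro u v
    change e u ⋖ e v ∨ e v ⋖ e u ↔ F.Adj u.1 v.1
    rw [apply_covBy_apply_iff, apply_covBy_apply_iff]
    constructor
    · rintro (h | h)
      · exact hcov _ _ h
      · exact (hcov _ _ h).symm
    · intro h
      exact (hF _ _ h).imp (hcov' _ _) (hcov' _ _)

/-- `S` lists the pairs of first vertex and remaining vertices of disjoint paths of `G` that
together cover all vertices. -/
structure IsPathPartition {V : Type*} (G : SimpleGraph V) (S : List (V × List V)) : Prop where
  chain : ∀ s ∈ S, (s.1 :: s.2).IsChain G.Adj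
  nodup : (S.flatMap fun s => s.1 :: s.2).Nodup
  cover : ∀ v, v ∈ S.flatMap fun s => s.1 :: s.2

theorem IsPathPartition.perm {V : Type*} {G : SimpleGraph V} {S S' : List (V × List V)}
    (h : G.IsPathPartition S) (hS : S.Perm S') : G.IsPathPartition S' where
  chain s hs := h.chain s (hS.mem_iff.2 hs)
  nodup := (hS.flatMap_right _).nodup_iff.1 h.nodup
  cover v := (hS.flatMap_right _).mem_iff.1 (h.cover v)

/-- The path through `u` is cut just before `u`. -/
theorem IsPathPartition.exists_cut {V : Type*} {G : SimpleGraph V} {S : List (V × List V)}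
    (h : G.IsPathPartition S) (u : V) (hu : u ∉ S.map Prod.fst) :
    ∃ S', G.IsPathPartition S' ∧ (S'.map Prod.fst).Perm (u :: S.map Prod.fst) := by
  obtain ⟨s, hs, hus⟩ := List.mem_flatMap.1 (h.cover u)
  have hne : u ≠ s.1 := by
    rintro rfl
    exact hu (List.mem_map_of_mem hs)
  obtain ⟨x, l⟩ := s
  simp only [List.mem_cons, hne, false_or] at hus
  obtain ⟨t₁, t₂, rfl⟩ := List.append_of_mem hus
  obtain ⟨L₁, L₂, rfl⟩ := List.append_of_mem hs
  set S₁ := L₁ ++ L₂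
  have hS₁ : (L₁ ++ (x, t₁ ++ u :: t₂) :: L₂).Perm ((x, t₁ ++ u :: t₂) :: S₁) := List.perm_middle
  have h1 := h.perm hS₁
  refine ⟨(u, t₂) :: (x, t₁) :: S₁, ⟨?_, ?_, ?_⟩, ?_⟩
  · have h2 := h1.chain _ List.mem_cons_self
    simp only [← List.cons_append] at h2
    rw [List.isChain_append] at h2
    intro s hs
    rcases List.mem_cons.1 hs with rfl | hs
    · exact h2.2.1
    rcases List.mem_cons.1 hs with rfl | hs
    · exact h2.1
    · exact h1.chain _ (List.mem_cons_of_mem _ hs)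
  · have hp : (List.flatMap (fun s => s.1 :: s.2) ((x, t₁ ++ u :: t₂) :: S₁)).Perm
        (List.flatMap (fun s => s.1 :: s.2) ((u, t₂) :: (x, t₁) :: S₁)) := by
      simp only [List.flatMap_cons]
      rw [← List.append_assoc]
      refine List.Perm.append_right _ ?_
      exact (List.perm_append_comm (l₁ := x :: t₁) (l₂ := u :: t₂))
    exact hp.nodup_iff.1 h1.nodup
  · intro v
    have := h1.cover v
    simp only [List.flatMap_cons, List.mem_append, List.mem_cons] at this ⊢
    tauto
  · simp only [List.map_cons]
    exact List.Perm.cons _ (hS₁.map Prod.fst).symm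

theorem IsPathPartition.exists_superset {V : Type*} [DecidableEq V] {G : SimpleGraph V}
    (R T : Finset V) {S : List (V × List V)} (h : G.IsPathPartition S)
    (hS : (S.map Prod.fst).Perm T.toList) (hR : Disjoint T R) :
    ∃ S', G.IsPathPartition S' ∧ (S'.map Prod.fst).Perm (T ∪ R).toList := by
  induction R using Finset.induction_on with
  | empty => exact ⟨S, h, by simpa using hS⟩
  | insert u R hu ih =>
    rw [Finset.disjoint_insert_right] at hR
    obtain ⟨S', h', hS'⟩ := ih hR.2
    have hu' : u ∉ T ∪ R := by simp [hu, hR.1]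
    obtain ⟨S'', h'', hS''⟩ := h'.exists_cut u (by rw [hS'.mem_iff]; simpa using hu')
    refine ⟨S'', h'', hS''.trans ?_⟩
    rw [Finset.union_insert]
    exact (hS'.cons u).trans (Finset.toList_insert hu').symm

/-- Each component is read off as a list along its path. Every edge joins a vertex that is not a
head to its predecessor, so there are at most as many edges as non-heads. -/
theorem IsLinearForest.exists_isPathPartition {V : Type*} [Fintype V] {F : SimpleGraph V}
    (hF : F.IsLinearForest) : ∃ (S : List (V × List V)) (T : Finset V), F.IsPathPartition S ∧
      (S.map Prod.fst).Perm T.toList ∧ T.card + F.edgeSet.ncard ≤ Fintype.card V := by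
  classical
  have h0 : ∀ c : F.ConnectedComponent, ∃ m : ℕ,
      Nonempty (c.toSimpleGraph ≃g pathGraph (m + 1)) := by
    intro c
    obtain ⟨m, ⟨e⟩⟩ := hF.2 c
    cases m with
    | zero =>
      obtain ⟨v, hv⟩ := c.exists_rep
      exact (e ⟨v, hv⟩).elim0
    | succ m => exact ⟨m, ⟨e⟩⟩
  choose m he using h0
  let e := fun c => (he c).some
  let g : ∀ c, Fin (m c + 1) → V := fun c i => ((e c).symm i).1
  have hg : ∀ c i, F.connectedComponentMk (g c i) = c := fun c i => ((e c).symm i).2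
  have hginj : ∀ c, Function.Injective (g c) := fun c i j h =>
    (e c).symm.injective (Subtype.ext h)
  have hgs : ∀ v, ∃ i, g (F.connectedComponentMk v) i = v := by
    intro v
    refine ⟨e _ ⟨v, rfl⟩, ?_⟩
    simp [g]
  have hgadj : ∀ c i j, F.Adj (g c i) (g c j) ↔ (pathGraph (m c + 1)).Adj i j := by
    intro c i j
    exact ((e c).symm.map_rel_iff' (a := i) (b := j))
  choose pos hpos using hgs
  let hd : F.ConnectedComponent → V := fun c => g c 0
  have hhd : Function.Injective hd := by
    intro c d h
    rw [← hg c 0, ← hg d 0]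
    exact congrArg _ h
  have hlist : ∀ c, hd c :: (List.ofFn fun i : Fin (m c) => g c i.succ) = List.ofFn (g c) := by
    intro c
    rw [List.ofFn_succ]
  refine ⟨(Finset.univ : Finset F.ConnectedComponent).toList.map
    (fun c => (hd c, List.ofFn fun i : Fin (m c) => g c i.succ)),
    Finset.univ.image hd, ⟨?_, ?_, ?_⟩, ?_, ?_⟩
  · intro s hs
    obtain ⟨c, -, rfl⟩ := List.mem_map.1 hs
    simp only [hlist]
    rw [List.isChain_ofFn]
    intro i hi
    rw [hgadj, pathGraph_adj]
    simp
  · rw [List.flatMap_map, List.nodup_flatMap]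
    simp only [hlist]
    refine ⟨fun c _ => List.nodup_ofFn.2 (hginj c), ?_⟩
    refine (Finset.nodup_toList _).imp ?_
    intro c d hcd v hv hv'
    rw [List.mem_ofFn] at hv hv'
    obtain ⟨i, rfl⟩ := hv
    obtain ⟨j, hj⟩ := hv'
    apply hcd
    rw [← hg c i, ← hj, hg]
  · intro v
    rw [List.flatMap_map, List.mem_flatMap]
    simp only [hlist]
    exact ⟨F.connectedComponentMk v, by simp, List.mem_ofFn.2 ⟨_, hpos v⟩⟩
  · rw [List.map_map]
    refine (List.perm_ext_iff_of_nodup ?_ (Finset.nodup_toList _)).2 ?_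
    · exact (Finset.nodup_toList _).map hhd
    · intro v
      simp
  -- The predecessor on the path; the truncated value at a head is never used.
  · let pr : V → V := fun v => g (F.connectedComponentMk v) ⟨(pos v).1 - 1, by omega⟩
    have hpr : ∀ c (i j : Fin (m c + 1)), i.1 + 1 = j.1 → pr (g c j) = g c i := by
      intro c i j hij
      have aux : ∀ v, F.connectedComponentMk v = c → g c j = v → pr v = g c i := by
        rintro v rfl hv
        have hp : pos v = j := hginj _ ((hpos v).trans hv.symm)
        simp only [pr, hp]
        congr 1
        exact Fin.ext (by simp; omega)
      exact aux _ (hg c j) rfl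
    have h1 : F.edgeSet ⊆ (fun v => s(pr v, v)) '' {v | v ∉ Finset.univ.image hd} := by
      have aux : ∀ c (i j : Fin (m c + 1)), i.1 + 1 = j.1 →
          s(g c i, g c j) ∈ (fun v => s(pr v, v)) '' {v | v ∉ Finset.univ.image hd} := by
        intro c i j hij
        refine ⟨g c j, ?_, ?_⟩
        · simp only [Finset.mem_image, Finset.mem_univ, true_and, Set.mem_ofPred_eq, not_exists]
          intro d hd'
          have hdc : d = c := by rw [← hg d 0, ← hg c j]; exact congrArg _ hd'
          subst hdc
          have := hginj d hd'
          rw [← this] at hij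
          simp at hij
        · simp only [hpr c i j hij]
      intro x hx
      induction x using Sym2.ind with | _ u v =>
      have huv : F.Adj u v := hx
      have hc := ConnectedComponent.sound huv.reachable
      obtain ⟨i, hi⟩ : ∃ i, g (F.connectedComponentMk u) i = u := ⟨_, hpos u⟩
      obtain ⟨j, hj⟩ : ∃ j, g (F.connectedComponentMk u) j = v := by rw [hc]; exact ⟨_, hpos v⟩
      have h4 := huv
      rw [← hi, ← hj] at h4
      generalize F.connectedComponentMk u = c at i j hi hj h4
      rw [hgadj, pathGraph_adj] at h4
      rcases h4 with h4 | h4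
      · simpa only [hi, hj] using aux c i j h4
      · rw [Sym2.eq_swap]
        simpa only [hi, hj] using aux c j i h4
    have h2 := (Set.ncard_le_ncard h1 (Set.toFinite _)).trans (Set.ncard_image_le (Set.toFinite _))
    have h3 : {v | v ∉ Finset.univ.image hd}.ncard = Fintype.card V - (Finset.univ.image hd).card := by
      rw [← Finset.card_compl, ← Set.ncard_coe_finset]
      congr 1
      ext; simp
    have := Finset.card_le_univ (Finset.univ.image hd)
    omega

theorem IsPathPartition.mono {V : Type*} {F G : SimpleGraph V} {S : List (V × List V)}
    (h : F.IsPathPartition S) (hFG : F ≤ G) : G.IsPathPartition S where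
  chain s hs := (h.chain s hs).imp fun _ _ h => hFG h
  nodup := h.nodup
  cover := h.cover

/-- Heads of paths in a partition into few paths may be enlarged at will. -/
theorem exists_heads {V : Type*} [Fintype V] [DecidableEq V] (G : SimpleGraph V) :
    ∃ T : Finset V, T.card + G.maxLinearForest ≤ Fintype.card V ∧ ∀ T', T ⊆ T' →
      ∃ S, G.IsPathPartition S ∧ (S.map Prod.fst).Perm T'.toList := by
  obtain ⟨F, hFG, hF, hm⟩ := G.isGreatest_maxLinearForest.1
  obtain ⟨S, T, hS, hST, hT⟩ := hF.exists_isPathPartition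
  refine ⟨T, hm ▸ hT, fun T' hT' => ?_⟩
  have := (hS.mono hFG).exists_superset (T' \ T) T hST Finset.disjoint_sdiff
  rwa [Finset.union_sdiff_of_subset hT'] at this


/-! ### Counting along a hamiltonian path -/

/-- A hamiltonian path, given by its sequence of vertices. -/
structure IsHamiltonianSeq {X : Type*} (G : SimpleGraph X) (M : ℕ) (g : ℕ → X) : Prop where
  inj : ∀ s t, s ≤ M → t ≤ M → g s = g t → s = t
  surj : ∀ x, ∃ t ≤ M, g t = x
  adj : ∀ t < M, G.Adj (g t) (g (t + 1))

theorem Walk.IsHamiltonian.isHamiltonianSeq {X : Type*} [DecidableEq X] {G : SimpleGraph X}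
    {u v : X} {p : G.Walk u v} (hp : p.IsHamiltonian) : G.IsHamiltonianSeq p.length p.getVert where
  inj s t hs ht h := hp.isPath.getVert_injOn hs ht h
  surj x := by
    obtain ⟨t, h, ht⟩ := Walk.mem_support_iff_exists_getVert.1 (hp.mem_support x)
    exact ⟨t, ht, h⟩
  adj t ht := p.adj_getVert_succ ht

namespace IsHamiltonianSeq

variable {X : Type*} {G : SimpleGraph X} {M : ℕ} {g : ℕ → X}

/-- The steps inside the copy of `H` form a linear forest, since position along the path is an
injection to `ℕ` under which they join consecutive numbers. -/
theorem card_le_maxLinearForest (hg : G.IsHamiltonianSeq M g) {V : Type*} [Finite V]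
    (H : SimpleGraph V) (emb : V → X) (hemb : Function.Injective emb)
    (hH : ∀ u v, G.Adj (emb u) (emb v) → H.Adj u v) (P : X → Prop) [DecidablePred P]
    (hP : ∀ x, P x → ∃ v, emb v = x) :
    ((Finset.range M).filter fun t => P (g t) ∧ P (g (t + 1))).card ≤ H.maxLinearForest := by
  choose f hfM hf using hg.surj
  let F : SimpleGraph V :=
    { Adj := fun u v => H.Adj u v ∧ (f (emb u) + 1 = f (emb v) ∨ f (emb v) + 1 = f (emb u))
      symm := ⟨fun u v h => ⟨h.1.symm, h.2.symm⟩⟩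
      loopless := ⟨fun u h => h.1.ne rfl⟩ }
  have hF : F.IsLinearForest := by
    refine isLinearForest_of_injective F (fun v => f (emb v)) ?_ fun u v h => h.2
    intro u v h
    apply hemb
    rw [← hf (emb u), ← hf (emb v)]
    exact congrArg g h
  have hfin : F.edgeSet.Finite := Set.toFinite _
  refine le_trans ?_ (H.isGreatest_maxLinearForest.2 ⟨F, fun u v h => h.1, hF, rfl⟩)
  rw [← Set.ncard_coe_finset]
  -- A step is recovered from its edge as the smaller of the two positions.
  refine le_trans (Set.ncard_le_ncard (t := (fun e => (Sym2.map (fun v => f (emb v)) e).inf) ''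
    F.edgeSet) ?_ (hfin.image _)) (Set.ncard_image_le hfin)
  intro t ht
  simp only [Finset.coe_filter, Finset.mem_range, Set.mem_ofPred_eq] at ht
  obtain ⟨htM, h1, h2⟩ := ht
  obtain ⟨u, hu⟩ := hP _ h1
  obtain ⟨v, hv⟩ := hP _ h2
  have hfu : f (emb u) = t := hg.inj _ _ (hfM _) htM.le (by rw [hf, hu])
  have hfv : f (emb v) = t + 1 := hg.inj _ _ (hfM _) htM (by rw [hf, hv])
  refine ⟨s(u, v), ⟨hH _ _ ?_, ?_⟩, ?_⟩
  · rw [hu, hv]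
    exact hg.adj t htM
  · left; rw [hfu, hfv]
  · simp [hfu, hfv]

theorem sum_indicator (hg : G.IsHamiltonianSeq M g) [Fintype X] (P : X → Prop) [DecidablePred P] :
    ∑ t ∈ Finset.range (M + 1), (if P (g t) then 1 else 0) =
      (Finset.univ.filter P).card := by
  rw [Finset.sum_boole, Nat.cast_id]
  refine Finset.card_bij (fun t _ => g t) ?_ ?_ ?_
  · intro t ht
    simp only [Finset.mem_filter, Finset.mem_range] at ht
    simpa using ht.2
  · intro s hs t ht h
    simp only [Finset.mem_filter, Finset.mem_range] at hs ht
    exact hg.inj _ _ (by omega) (by omega) h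
  · intro x hx
    obtain ⟨t, ht, rfl⟩ := hg.surj x
    simp only [Finset.mem_filter, Finset.mem_univ, true_and] at hx
    exact ⟨t, by simp only [Finset.mem_filter, Finset.mem_range]; exact ⟨by omega, hx⟩, rfl⟩

/-- Each vertex belongs to two steps, except that each end of the sequence misses one. -/
theorem sum_pairs (hg : G.IsHamiltonianSeq M g) [Fintype X] (P : X → Prop) [DecidablePred P] :
    ∑ t ∈ Finset.range M, ((if P (g t) then 1 else 0) + (if P (g (t + 1)) then 1 else 0)) +
      (if P (g 0) then 1 else 0) + (if P (g M) then 1 else 0) =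
      2 * (Finset.univ.filter P).card := by
  have h1 := hg.sum_indicator P
  have h2 := h1
  rw [Finset.sum_range_succ] at h1
  rw [Finset.sum_range_succ'] at h2
  rw [Finset.sum_add_distrib]
  omega

theorem card_eq (hg : G.IsHamiltonianSeq M g) [Fintype X] : M + 1 = Fintype.card X := by
  simpa using hg.sum_indicator fun _ => True

theorem exists_crossing (hg : G.IsHamiltonianSeq M g) (P : X → Prop) (hP : ∃ x, P x)
    (hP' : ∃ x, ¬ P x) : ∃ t < M, ¬ (P (g t) ↔ P (g (t + 1))) := by
  by_contra! h
  have h' : ∀ t ≤ M, (P (g t) ↔ P (g 0)) := by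
    intro t
    induction t with
    | zero => simp
    | succ t ih => intro ht; rw [← h t (by omega)]; exact ih (by omega)
  obtain ⟨x, hx⟩ := hP
  obtain ⟨y, hy⟩ := hP'
  obtain ⟨s, hs, rfl⟩ := hg.surj x
  obtain ⟨t, ht, rfl⟩ := hg.surj y
  exact hy ((h' t ht).2 ((h' s hs).1 hx))

/-- If all neighbours outside `A` of vertices in `A` are in the equally large set `B`, then a
hamiltonian path with many ends in `B` has many edges inside `A`. -/
theorem le_two_mul_card (hg : G.IsHamiltonianSeq M g) [Fintype X] (A B : X → Prop)
    [DecidablePred A] [DecidablePred B] (hAB : ∀ x, A x → ¬ B x)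
    (hA : ∀ x y, G.Adj x y → A x → A y ∨ B y)
    (hcard : (Finset.univ.filter A).card = (Finset.univ.filter B).card)
    (h1 : ∃ x, A x) (h2 : ∃ x, ¬ A x ∧ ¬ B x) :
    (if B (g 0) then 1 else 0) + (if B (g M) then 1 else 0) + 1 ≤
    2 * ((Finset.range M).filter fun t => A (g t) ∧ A (g (t + 1))).card +
      (if A (g 0) then 1 else 0) + (if A (g M) then 1 else 0) := by
  obtain ⟨t, ht, htc⟩ := hg.exists_crossing (fun x => A x ∨ B x) (h1.imp fun x hx => Or.inl hx)
    (h2.imp fun x hx => by tauto)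
  -- A step has at most as many ends in `A` as in `B`, unless it lies inside `A`. A step leaving `A
  -- ∪ B` leaves from `B`, which gains one; the crossing at `t` is the source of the `+ 1`.
  have hsum : ∑ t ∈ Finset.range M, (((if A (g t) then 1 else 0) +
      (if A (g (t + 1)) then 1 else 0)) +
      (if (A (g t) ∨ B (g t) ↔ A (g (t + 1)) ∨ B (g (t + 1))) then 0 else 1)) ≤
      ∑ t ∈ Finset.range M, (2 * (if A (g t) ∧ A (g (t + 1)) then 1 else 0) +
        ((if B (g t) then 1 else 0) + (if B (g (t + 1)) then 1 else 0))) := by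
    refine Finset.sum_le_sum fun t ht => ?_
    have e := hg.adj t (Finset.mem_range.1 ht)
    have e1 := hA _ _ e
    have e2 := hA _ _ e.symm
    have e3 := hAB (g t)
    have e4 := hAB (g (t + 1))
    by_cases a1 : A (g t) <;> by_cases a2 : A (g (t + 1)) <;> by_cases b1 : B (g t) <;>
      by_cases b2 : B (g (t + 1)) <;> simp_all
  have hone : 1 ≤ ∑ t ∈ Finset.range M,
      (if (A (g t) ∨ B (g t) ↔ A (g (t + 1)) ∨ B (g (t + 1))) then 0 else 1) := by
    refine le_trans ?_ (Finset.single_le_sum (fun _ _ => Nat.zero_le _) (Finset.mem_range.2 ht))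
    rw [if_neg htc]
  have hcA := hg.sum_pairs A
  have hcB := hg.sum_pairs B
  rw [Finset.sum_add_distrib, Finset.sum_add_distrib (g := fun t =>
    (if B (g t) then 1 else 0) + (if B (g (t + 1)) then 1 else 0)), ← Finset.mul_sum] at hsum
  rw [Finset.card_filter]
  omega

end IsHamiltonianSeq

/-! ### Necessary conditions in the product -/

section Product

variable {k n : ℕ} {V : Fin (2 * k + 1) → Type*} [∀ i, Fintype (V i)]
  {H : ∀ i, SimpleGraph (V i)}

theorem genLexProduct_adj_same {ι : Type*} {V : ι → Type*} {G : SimpleGraph ι}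
    {H : ∀ i, SimpleGraph (V i)} {i : ι} {u v : V i} :
    (G.genLexProduct H).Adj ⟨i, u⟩ ⟨i, v⟩ ↔ (H i).Adj u v := by
  constructor
  · rintro (h | ⟨j, a, b, h, h1, h2⟩)
    · exact (G.loopless.irrefl _ h).elim
    · cases h1
      cases h2
      exact h
  · intro h
    exact Or.inr ⟨i, u, v, h, rfl, rfl⟩

theorem genLexProduct_adj_fst {ι : Type*} {V : ι → Type*} {G : SimpleGraph ι}
    {H : ∀ i, SimpleGraph (V i)} {x y : Σ i, V i} (h : (G.genLexProduct H).Adj x y) :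
    x.1 = y.1 ∨ G.Adj x.1 y.1 := by
  rcases h with h | ⟨j, a, b, h, rfl, rfl⟩
  · exact Or.inr h
  · exact Or.inl rfl

theorem card_level {ι : Type*} [DecidableEq ι] [Fintype ι] {V : ι → Type*} [∀ i, Fintype (V i)]
    (i : ι) : (Finset.univ.filter fun x : Σ i, V i => x.1 = i).card = Fintype.card (V i) := by
  rw [← Fintype.card_subtype]
  exact Fintype.card_congr (Equiv.sigmaSubtype i)

theorem sum_even_add_odd (i : Fin (2 * k + 1)) :
    (∑ j : Fin (k + 1), if i = ⟨2 * j, by omega⟩ then 1 else 0) + (if Odd i.1 then 1 else 0) = 1 := by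
  rcases Nat.even_or_odd' i.1 with ⟨c, hc | hc⟩
  · rw [Finset.sum_eq_single ⟨c, by omega⟩]
    · have : ¬ Odd i.1 := by rw [hc]; simp
      rw [if_neg this, if_pos (Fin.ext hc)]
    · intro j _ hj
      rw [if_neg]
      intro h
      apply hj
      rw [Fin.ext_iff] at h ⊢
      simp only at h ⊢
      omega
    · simp
  · rw [Finset.sum_eq_zero]
    · rw [if_pos ⟨c, hc⟩]
    · intro j _
      rw [if_neg]
      intro h
      rw [Fin.ext_iff] at h
      simp only at h
      omega

theorem card_odd_levels (hV : ∀ i, Fintype.card (V i) = n) :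
    (Finset.univ.filter fun x : Σ i, V i => Odd x.1.1).card = k * n := by
  have h1 : ∑ x : Σ i, V i, ((∑ j : Fin (k + 1), if x.1 = ⟨2 * j, by omega⟩ then 1 else 0) +
      (if Odd x.1.1 then 1 else 0)) = ∑ x : Σ i, V i, 1 :=
    Finset.sum_congr rfl fun x _ => sum_even_add_odd x.1
  rw [Finset.sum_add_distrib, Finset.sum_comm] at h1
  simp only [Finset.sum_boole, Nat.cast_id, card_level, hV, Finset.sum_const, Finset.card_univ,
    Fintype.card_fin, Fintype.card_sigma, smul_eq_mul, mul_one] at h1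
  nlinarith

theorem IsHamiltonianSeq.le_sum_maxLinearForest {M : ℕ} {g : ℕ → Σ i, V i}
    (hg : ((pathGraph (2 * k + 1)).genLexProduct H).IsHamiltonianSeq M g)
    (hV : ∀ i, Fintype.card (V i) = n) :
    n + (if Odd (g 0).1.1 then 1 else 0) + (if Odd (g M).1.1 then 1 else 0) ≤
      ∑ j : Fin (k + 1), (H ⟨2 * j, by omega⟩).maxLinearForest + 1 := by
  -- A step avoiding the odd levels cannot change level, so it lies inside one even level.
  have h1 : ∑ t ∈ Finset.range M, 1 ≤ ∑ t ∈ Finset.range M,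
      ((∑ j : Fin (k + 1), if (g t).1 = ⟨2 * j, by omega⟩ ∧ (g (t + 1)).1 = ⟨2 * j, by omega⟩
        then 1 else 0) +
      ((if Odd (g t).1.1 then 1 else 0) + (if Odd (g (t + 1)).1.1 then 1 else 0))) := by
    refine Finset.sum_le_sum fun t ht => ?_
    by_cases o1 : Odd (g t).1.1
    · rw [if_pos o1]; omega
    by_cases o2 : Odd (g (t + 1)).1.1
    · rw [if_pos o2]; omega
    have e : (g t).1 = (g (t + 1)).1 := by
      rcases genLexProduct_adj_fst (hg.adj t (Finset.mem_range.1 ht)) with h | h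
      · exact h
      · rw [pathGraph_adj] at h
        rw [Nat.not_odd_iff] at o1 o2
        omega
    have := sum_even_add_odd (g t).1
    simp only [← e, and_self]
    omega
  rw [Finset.sum_add_distrib, Finset.sum_comm, Finset.sum_const, Finset.card_range] at h1
  have h2 : ∑ j : Fin (k + 1), ∑ t ∈ Finset.range M,
      (if (g t).1 = ⟨2 * j, by omega⟩ ∧ (g (t + 1)).1 = ⟨2 * j, by omega⟩ then 1 else 0) ≤
      ∑ j : Fin (k + 1), (H ⟨2 * j, by omega⟩).maxLinearForest := by
    refine Finset.sum_le_sum fun j _ => ?_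
    rw [Finset.sum_boole, Nat.cast_id]
    refine hg.card_le_maxLinearForest (H ⟨2 * j, by omega⟩) (fun v => ⟨_, v⟩)
      sigma_mk_injective (fun u v h => genLexProduct_adj_same.1 h)
      (fun x => x.1 = ⟨2 * j, by omega⟩) ?_
    rintro ⟨i, v⟩ rfl
    exact ⟨v, rfl⟩
  have h3 := hg.sum_pairs fun x => Odd x.1.1
  have h4 := hg.card_eq
  rw [card_odd_levels hV] at h3
  simp only [Fintype.card_sigma, hV, Finset.sum_const, Finset.card_univ, Fintype.card_fin,
    smul_eq_mul] at h4
  have h5 : (2 * k + 1) * n = 2 * (k * n) + n := by ring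
  simp only [smul_eq_mul, mul_one] at h1
  omega

theorem IsHamiltonianSeq.le_maxLinearForest_end {M : ℕ} {g : ℕ → Σ i, V i}
    (hg : ((pathGraph (2 * k + 1)).genLexProduct H).IsHamiltonianSeq M g)
    (hV : ∀ i, Fintype.card (V i) = n) (hn : 1 ≤ n) (i₀ i₁ i₂ : Fin (2 * k + 1)) (h01 : i₀ ≠ i₁)
    (h02 : i₂ ≠ i₀) (h12 : i₂ ≠ i₁) (hi : ∀ i, (pathGraph (2 * k + 1)).Adj i₀ i → i = i₁) :
    (if (g 0).1 = i₁ then 1 else 0) + (if (g M).1 = i₁ then 1 else 0) + 1 ≤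
      2 * (H i₀).maxLinearForest +
      (if (g 0).1 = i₀ then 1 else 0) + (if (g M).1 = i₀ then 1 else 0) := by
  have hne : ∀ i, ∃ x : Σ i, V i, x.1 = i := by
    intro i
    have : 0 < Fintype.card (V i) := by rw [hV]; exact hn
    obtain ⟨v⟩ := Fintype.card_pos_iff.1 this
    exact ⟨⟨i, v⟩, rfl⟩
  have h1 := hg.le_two_mul_card (fun x => x.1 = i₀) (fun x => x.1 = i₁)
    (fun x h h' => h01 (h.symm.trans h')) (fun x y hxy hx => by
      rcases genLexProduct_adj_fst hxy with h | h
      · exact Or.inl (h.symm.trans hx)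
      · exact Or.inr (hi _ (hx ▸ h))) (by rw [card_level, card_level, hV, hV]) (hne i₀)
      ((hne i₂).imp fun x hx => by rw [hx]; exact ⟨h02, h12⟩)
  have h2 := hg.card_le_maxLinearForest (H i₀) (fun v => ⟨_, v⟩)
      sigma_mk_injective (fun u v h => genLexProduct_adj_same.1 h)
      (fun x => x.1 = i₀) (by
    rintro ⟨i, v⟩ rfl
    exact ⟨v, rfl⟩)
  omega

end Product


/-! ### Walks on the levels with prescribed visit numbers -/

/-- There is a walk from `a` to `b` in the two-way infinite path on `ℕ` that visits each `i`
exactly `m i` times. -/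
def HasLevelWalk (a b : ℕ) (m : ℕ → ℕ) : Prop :=
  ∃ l : List ℕ, l.IsChain (fun x y => x + 1 = y ∨ y + 1 = x) ∧ l.head? = some a ∧
    l.getLast? = some b ∧ ∀ i, l.count i = m i

theorem HasLevelWalk.congr {a b : ℕ} {m m' : ℕ → ℕ} (h : HasLevelWalk a b m)
    (hm : ∀ i, m i = m' i) : HasLevelWalk a b m' :=
  funext hm ▸ h

/-- One visit to `j` is replaced by `j, j', j`. -/
theorem HasLevelWalk.insert {a b : ℕ} {m : ℕ → ℕ} (h : HasLevelWalk a b m) {j j' : ℕ}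
    (hj : 1 ≤ m j) (hjj : j + 1 = j' ∨ j' + 1 = j) :
    HasLevelWalk a b (fun i => m i + ((if i = j then 1 else 0) + (if i = j' then 1 else 0))) := by
  obtain ⟨l, hc, ha, hb, hm⟩ := h
  have hjl : j ∈ l := by
    rw [← List.one_le_count_iff, hm]
    exact hj
  obtain ⟨l₁, l₂, rfl⟩ := List.append_of_mem hjl
  refine ⟨l₁ ++ j :: j' :: j :: l₂, ?_, ?_, ?_, ?_⟩
  · rw [List.isChain_append] at hc ⊢
    refine ⟨hc.1, ?_, ?_⟩
    · rw [List.isChain_cons_cons, List.isChain_cons_cons]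
      exact ⟨hjj, hjj.symm, hc.2.1⟩
    · simpa using hc.2.2
  · cases l₁ <;> simpa using ha
  · simp only [List.getLast?_append, List.getLast?_cons] at hb ⊢
    simpa using hb
  · intro i
    beta_reduce
    rw [← hm i]
    simp only [List.count_append, List.count_cons, beq_iff_eq, eq_comm (b := i)]
    omega

theorem HasLevelWalk.insert_many {a b : ℕ} {m : ℕ → ℕ} (h : HasLevelWalk a b m) {j j' : ℕ}
    (hj : 1 ≤ m j) (hjj : j + 1 = j' ∨ j' + 1 = j) (w : ℕ) :
    HasLevelWalk a b (fun i => m i +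
      ((if i = j then w else 0) + (if i = j' then w else 0))) := by
  induction w with
  | zero => simpa using h
  | succ w ih =>
    have := ih.insert (j := j) (j' := j') (by omega) hjj
    refine HasLevelWalk.congr this fun i => ?_
    split_ifs <;> omega

theorem hasLevelWalk_monotone (a d : ℕ) :
    HasLevelWalk a (a + d) (fun i => if a ≤ i ∧ i ≤ a + d then 1 else 0) := by
  induction d with
  | zero =>
    refine ⟨[a], by simp, by simp, by simp, ?_⟩
    intro i
    simp only [List.count_singleton, beq_iff_eq]
    split_ifs <;> omega
  | succ d ih =>
    obtain ⟨l, hc, ha, hb, hm⟩ := ih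
    refine ⟨l ++ [a + (d + 1)], ?_, ?_, by simp, ?_⟩
    · rw [List.isChain_append]
      refine ⟨hc, by simp, ?_⟩
      intro x hx y hy
      rw [hb] at hx
      simp at hx hy
      omega
    · rw [List.head?_append, ha]
      rfl
    · intro i
      rw [List.count_append, hm, List.count_singleton]
      simp only [beq_iff_eq]
      split_ifs <;> omega

/-- `w i` counts the round trips between `i` and `i + 1`. They are inserted upwards from `a`, then
downwards. Between `a` and `b` the monotone walk supplies the visit to attach to; elsewhere the
preceding round trips must, whence the positivity of `w`. -/
theorem hasLevelWalk_of_roundTrips (a b K : ℕ) (hab : a ≤ b) (hbK : b ≤ K) (w : ℕ → ℕ)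
    (hw : ∀ i, i < K → (i < a ∨ b ≤ i) → 1 ≤ w i) :
    HasLevelWalk a b (fun i => (if a ≤ i ∧ i ≤ b then 1 else 0) +
      (if i < K then w i else 0) + (if 1 ≤ i ∧ i ≤ K then w (i - 1) else 0)) := by
  have up : ∀ d, a + d ≤ K → HasLevelWalk a b (fun i => (if a ≤ i ∧ i ≤ b then 1 else 0) +
      (if a ≤ i ∧ i < a + d then w i else 0) +
      (if a < i ∧ i ≤ a + d then w (i - 1) else 0)) := by
    intro d
    induction d with
    | zero =>
      intro _
      obtain ⟨e, rfl⟩ := Nat.exists_eq_add_of_le hab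
      refine HasLevelWalk.congr (hasLevelWalk_monotone a e) fun i => ?_
      split_ifs <;> omega
    | succ d ih =>
      intro hd
      have h1 := ih (by omega)
      have h2 := h1.insert_many (j := a + d) (j' := a + d + 1) (by
        by_cases hb : a + d ≤ b
        · rw [if_pos ⟨by omega, hb⟩]; omega
        · have := hw (a + d - 1) (by omega) (by omega)
          rw [if_pos (c := a < a + d ∧ _) ⟨by omega, by omega⟩]; omega) (Or.inl rfl) (w (a + d))
      refine HasLevelWalk.congr h2 fun i => ?_
      rcases lt_trichotomy i (a + d) with h | h | h
      · split_ifs <;> omega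
      · subst h
        split_ifs <;> omega
      · by_cases h' : i = a + d + 1
        · subst h'
          simp only [Nat.add_sub_cancel]
          split_ifs <;> omega
        · split_ifs <;> omega
  have down : ∀ d, d ≤ a → HasLevelWalk a b (fun i => (if a ≤ i ∧ i ≤ b then 1 else 0) +
      (if a - d ≤ i ∧ i < K then w i else 0) +
      (if a - d < i ∧ i ≤ K then w (i - 1) else 0)) := by
    intro d
    induction d with
    | zero =>
      intro _
      have := up (K - a) (by omega)
      rwa [Nat.add_sub_cancel' (by omega)] at this
    | succ d ih =>
      intro hd
      have h1 := ih (by omega)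
      have h2 := h1.insert_many (j := a - d) (j' := a - (d + 1)) (by
        by_cases hb : d = 0
        · rw [if_pos ⟨by omega, by omega⟩]; omega
        · have := hw (a - d) (by omega) (by omega)
          rw [if_pos (c := a - d ≤ a - d ∧ _) ⟨by omega, by omega⟩]; omega)
        (Or.inr (by omega)) (w (a - (d + 1)))
      refine HasLevelWalk.congr h2 fun i => ?_
      by_cases h : i = a - d
      · have h' : i - 1 = a - (d + 1) := by omega
        rw [h']
        split_ifs <;> omega
      by_cases h' : i = a - (d + 1)
      · rw [← h']
        split_ifs <;> omega
      · split_ifs <;> omega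
  refine HasLevelWalk.congr (down a le_rfl) fun i => ?_
  simp only [Nat.sub_self]
  split_ifs <;> omega

set_option maxHeartbeats 1000000 in
/-- The level walk needed for a hamiltonian path: `x j` is the number of edges used inside the
level `2 * j`. -/
theorem hasLevelWalk_of_sum (k n a b : ℕ) (hk : 1 ≤ k) (x : ℕ → ℕ) (hab : a ≤ b)
    (hb : b ≤ 2 * k)
    (hsum : ∑ j ∈ Finset.range (k + 1), x j + 1 = n + a % 2 + b % 2)
    (h0 : a % 2 + b % 2 ≤ x 0) (h0' : a = 0 ∨ 1 ≤ x 0)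
    (h1 : a % 2 + b % 2 ≤ x k) (h1' : b = 2 * k ∨ 1 ≤ x k) :
    HasLevelWalk a b (fun i => if i ≤ 2 * k then if i % 2 = 0 then n - x (i / 2) else n else 0) := by
  let s : ℕ → ℕ := fun j => ∑ i ∈ Finset.range j, x i
  have hs : ∀ j, s (j + 1) = s j + x j := fun j => Finset.sum_range_succ _ _
  have hmono : ∀ i j, i ≤ j → s i ≤ s j := fun i j h =>
    Finset.sum_le_sum_of_subset (Finset.range_mono h)
  -- This bound and `hsk` prevent truncation in `w` and make it positive outside `[a, b)`: the first
  -- uses `x 0` for odd `i`, the second `x k` for even `i`.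
  have hs1 : ∀ j, 1 ≤ j → x 0 ≤ s j := by
    intro j hj
    refine le_trans ?_ (hmono 1 j hj)
    simp [s]
  have hsk : ∀ j, j ≤ k → s j + x k + 1 ≤ n + a % 2 + b % 2 := by
    intro j hj
    have := hmono j k hj
    have := hs k
    have : s (k + 1) + 1 = n + a % 2 + b % 2 := hsum
    omega
  -- The solution of `w i + w (i - 1) + [a ≤ i ≤ b] = m i`, computed upwards from level `0` as an
  -- alternating sum. The equation at the top level `2 * k`, where no `w i` remains, is `hsum`.
  let w : ℕ → ℕ := fun i =>
    if i % 2 = 1 then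
      (s ((i + 1) / 2) + if b % 2 = 0 ∧ b ≤ i then 1 else 0) - if a % 2 = 1 ∧ a ≤ i then 1 else 0
    else (n + if b % 2 = 1 ∧ b ≤ i then 1 else 0) - s (i / 2 + 1) -
      if a % 2 = 0 ∧ a ≤ i then 1 else 0
  have wodd : ∀ j, w (2 * j + 1) = (s (j + 1) + if b % 2 = 0 ∧ b ≤ 2 * j + 1 then 1 else 0) -
      if a % 2 = 1 ∧ a ≤ 2 * j + 1 then 1 else 0 := by
    intro j
    have e1 : (2 * j + 1) % 2 = 1 := by omega
    have e2 : (2 * j + 1 + 1) / 2 = j + 1 := by omega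
    simp only [w, e1, e2, if_true]
  have weven : ∀ j, w (2 * j) = (n + if b % 2 = 1 ∧ b ≤ 2 * j then 1 else 0) - s (j + 1) -
      if a % 2 = 0 ∧ a ≤ 2 * j then 1 else 0 := by
    intro j
    have e1 : (2 * j) % 2 = 0 := by omega
    have e2 : (2 * j) / 2 = j := by omega
    simp only [w, e1, e2]
    rfl
  have htot : s (k + 1) + 1 = n + a % 2 + b % 2 := hsum
  have := hasLevelWalk_of_roundTrips a b (2 * k) hab hb w (by
    intro i hi hi'
    rcases Nat.even_or_odd' i with ⟨j, rfl | rfl⟩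
    · rw [weven]
      have := hsk (j + 1) (by omega)
      split_ifs <;> omega
    · rw [wodd]
      have := hs1 (j + 1) (by omega)
      split_ifs <;> omega)
  refine HasLevelWalk.congr this fun i => ?_
  by_cases hik : i ≤ 2 * k
  swap
  · split_ifs <;> omega
  rcases Nat.even_or_odd' i with ⟨j, rfl | rfl⟩
  · have e1 : (2 * j) % 2 = 0 := by omega
    have e2 : (2 * j) / 2 = j := by omega
    rw [if_pos hik, if_pos e1, e2, weven]
    have hsj := hs j
    have hle : j < k → s (j + 1) + x k + 1 ≤ n + a % 2 + b % 2 := fun h => hsk (j + 1) h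
    rcases Nat.eq_zero_or_pos j with rfl | hj
    · have : s 0 = 0 := rfl
      rcases Nat.mod_two_eq_zero_or_one a with ha | ha <;>
        rcases Nat.mod_two_eq_zero_or_one b with hb' | hb' <;>
        simp only [ha, hb', true_and, false_and, if_false, zero_ne_one, one_ne_zero] <;>
        split_ifs <;> omega
    · obtain ⟨j, rfl⟩ : ∃ j', j = j' + 1 := ⟨j - 1, by omega⟩
      have e3 : 2 * (j + 1) - 1 = 2 * j + 1 := by omega
      rw [e3, wodd]
      have h5 := hs1 (j + 1) (by omega)
      by_cases hjk : j + 1 = k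
      · subst hjk
        rcases Nat.mod_two_eq_zero_or_one a with ha | ha <;>
          rcases Nat.mod_two_eq_zero_or_one b with hb' | hb' <;>
          simp only [ha, hb', true_and, false_and, if_false, zero_ne_one, one_ne_zero] <;>
          split_ifs <;> omega
      · have hle' := hle (by omega)
        rcases Nat.mod_two_eq_zero_or_one a with ha | ha <;>
          rcases Nat.mod_two_eq_zero_or_one b with hb' | hb' <;>
          simp only [ha, hb', true_and, false_and, if_false, zero_ne_one, one_ne_zero] <;>
          split_ifs <;> omega
  · rw [if_pos hik, if_neg (by omega : ¬ (2 * j + 1) % 2 = 0), wodd]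
    have e3 : 2 * j + 1 - 1 = 2 * j := by omega
    rw [e3, weven]
    have h5 := hs1 (j + 1) (by omega)
    have h6 := hsk (j + 1) (by omega)
    rcases Nat.mod_two_eq_zero_or_one a with ha | ha <;>
      rcases Nat.mod_two_eq_zero_or_one b with hb' | hb' <;>
      simp only [ha, hb', true_and, false_and, if_false, zero_ne_one, one_ne_zero] <;>
      split_ifs <;> omega

/-- A discrete intermediate value argument, raising one coordinate at a time. -/
theorem exists_sum_eq {ι : Type*} (A : Finset ι) (lo hi : ι → ℕ) (h : ∀ i ∈ A, lo i ≤ hi i)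
    (t : ℕ) (h1 : ∑ i ∈ A, lo i ≤ t) (h2 : t ≤ ∑ i ∈ A, hi i) :
    ∃ x : ι → ℕ, (∀ i ∈ A, lo i ≤ x i ∧ x i ≤ hi i) ∧ ∑ i ∈ A, x i = t := by
  classical
  induction t, h1 using Nat.le_induction with
  | base => exact ⟨lo, fun i hi' => ⟨le_rfl, h i hi'⟩, rfl⟩
  | succ t _ ih =>
    obtain ⟨x, hx, hxt⟩ := ih (by omega)
    obtain ⟨i, hiA, hlt⟩ : ∃ i ∈ A, x i < hi i := by
      by_contra! hc
      have := Finset.sum_le_sum hc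
      omega
    refine ⟨Function.update x i (x i + 1), fun j hj => ?_, ?_⟩
    · have := hx j hj
      by_cases hji : j = i
      · subst hji; simp; omega
      · simpa [hji] using this
    · rw [Finset.sum_update_of_mem hiA, ← hxt,
        Finset.sum_eq_add_sum_sdiff_singleton_of_mem hiA x]
      omega


/-! ### Lifting a level walk to a hamiltonian path -/

theorem isChain_flatten_of_levels {X : Type*} {G : SimpleGraph X} {lev : X → ℕ}
    (hadj : ∀ x y, lev x + 1 = lev y → G.Adj x y) {L : List (List X)} {l : List ℕ}
    (h : List.Forall₂ (fun s i => s ≠ [] ∧ s.IsChain G.Adj ∧ ∀ x ∈ s, lev x = i) L l)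
    (hl : l.IsChain (fun x y => x + 1 = y ∨ y + 1 = x)) : L.flatten.IsChain G.Adj := by
  induction h with
  | nil => simp
  | cons hs hL ih =>
    rw [List.flatten_cons, List.isChain_append]
    refine ⟨hs.2.1, ih hl.tail, ?_⟩
    intro x hx y hy
    cases hL with
    | nil => simp at hy
    | cons hs' hL' =>
      rw [List.isChain_cons_cons] at hl
      rw [List.flatten_cons, List.head?_append_of_ne_nil _ hs'.1] at hy
      have hx' := hs.2.2 x (List.mem_of_getLast? hx)
      have hy' := hs'.2.2 y (List.mem_of_head? hy)
      rcases hl.1 with h | h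
      · exact hadj _ _ (by omega)
      · exact (hadj _ _ (by omega)).symm

theorem _root_.List.exists_perm_map_eq {α β : Type*} (f : α → β) {l : List α} {l' : List β}
    (h : (l.map f).Perm l') : ∃ t, l.Perm t ∧ t.map f = l' := by
  have h1 : Relation.Comp (List.Forall₂ fun a b => f a = b) List.Perm l l' := by
    refine ⟨l.map f, ?_, h⟩
    rw [List.forall₂_map_right_iff, List.forall₂_same]
    simp
  rw [List.forall₂_comp_perm_eq_perm_comp_forall₂] at h1
  obtain ⟨t, ht, h2⟩ := h1
  refine ⟨t, ht, ?_⟩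
  clear ht h
  induction h2 with
  | nil => rfl
  | cons h _ ih => rw [List.map_cons, h, ih]

theorem IsPathPartition.nodup_heads {V : Type*} {G : SimpleGraph V} {S : List (V × List V)}
    (h : G.IsPathPartition S) : (S.map Prod.fst).Nodup := by
  refine h.nodup.sublist ?_
  clear h
  induction S with
  | nil => simp
  | cons s S ih =>
    rw [List.map_cons, List.flatMap_cons, List.cons_append]
    exact (ih.trans (List.sublist_append_right _ _)).cons_cons _

/-- The paths are arranged in the order of the level walk, with the path of `u` first and that of
`v` last. The latter is reversed, so that its head `v` becomes the end. -/
theorem IsPathPartition.exists_isHamiltonian {X : Type*} [DecidableEq X] {G : SimpleGraph X}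
    {lev : X → ℕ} (hadj : ∀ x y, lev x + 1 = lev y → G.Adj x y) {S : List (X × List X)}
    (hS : G.IsPathPartition S) (hlev : ∀ s ∈ S, ∀ y ∈ s.2, lev y = lev s.1) {u v : X}
    (huv : u ≠ v) (hu : u ∈ S.map Prod.fst) (hv : v ∈ S.map Prod.fst) {m : ℕ → ℕ}
    (hm : HasLevelWalk (lev u) (lev v) m)
    (hcount : ∀ i, (S.map fun s => lev s.1).count i = m i) :
    ∃ p : G.Walk u v, p.IsHamiltonian := by
  obtain ⟨s, S₁, hS₁⟩ : ∃ s S₁, S.Perm ((u, s) :: S₁) := by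
    obtain ⟨⟨u, s⟩, hs, rfl⟩ := List.mem_map.1 hu
    obtain ⟨L₁, L₂, rfl⟩ := List.append_of_mem hs
    exact ⟨s, _, List.perm_middle⟩
  obtain ⟨t, S₂, hS₂⟩ : ∃ t S₂, S₁.Perm ((v, t) :: S₂) := by
    have hv' : v ∈ S₁.map Prod.fst := by
      have := (hS₁.map Prod.fst).mem_iff.1 hv
      rw [List.map_cons, List.mem_cons] at this
      exact this.resolve_left huv.symm
    obtain ⟨⟨u, s⟩, hs, rfl⟩ := List.mem_map.1 hv'
    obtain ⟨L₁, L₂, rfl⟩ := List.append_of_mem hs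
    exact ⟨s, _, List.perm_middle⟩
  have hS' : S.Perm ((u, s) :: (v, t) :: S₂) := hS₁.trans (hS₂.cons _)
  obtain ⟨l, hl, ha, hb, hlm⟩ := hm
  have hperm : (S.map fun s => lev s.1).Perm l := by
    rw [List.perm_iff_count]
    intro i
    rw [hcount, hlm]
  have hperm' := (hS'.map fun s => lev s.1).symm.trans hperm
  simp only [List.map_cons] at hperm'
  obtain ⟨l', rfl⟩ : ∃ l', l = lev u :: l' ++ [lev v] := by
    cases l with
    | nil => simp at ha
    | cons a l =>
      simp only [List.head?_cons, Option.some.injEq] at ha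
      subst ha
      rcases List.eq_nil_or_concat l with rfl | ⟨l', b, rfl⟩
      · have := hperm'.length_eq
        simp at this
      · refine ⟨l', ?_⟩
        rw [List.concat_eq_append, ← List.cons_append, List.getLast?_append] at hb
        simp at hb
        simp [hb]
  have hp2 : (S₂.map fun s => lev s.1).Perm l' := by
    have h1 : (lev u :: l' ++ [lev v]).Perm (lev u :: lev v :: l') := by
      rw [List.cons_append]
      exact (List.perm_append_singleton _ _).cons _
    exact ((hperm'.trans h1).cons_inv).cons_inv
  obtain ⟨T, hT, rfl⟩ := List.exists_perm_map_eq _ hp2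
  have hfin : S.Perm ((u, s) :: (v, t) :: T) := hS'.trans ((hT.cons _).cons _)
  have hPP := hS.perm hfin
  have hlev' : ∀ q ∈ ((u, s) :: (v, t) :: T), ∀ y ∈ q.2, lev y = lev q.1 :=
    fun q hq => hlev q (hfin.mem_iff.2 hq)
  let L : List (List X) := (u :: s) :: (T.map fun s => s.1 :: s.2) ++ [(v :: t).reverse]
  have hchain : L.flatten.IsChain G.Adj := by
    refine isChain_flatten_of_levels hadj ?_ hl
    have good : ∀ q ∈ ((u, s) :: (v, t) :: T), (q.1 :: q.2 ≠ []) ∧ (q.1 :: q.2).IsChain G.Adj ∧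
        ∀ x ∈ (q.1 :: q.2), lev x = lev q.1 := by
      intro q hq
      refine ⟨by simp, hPP.chain q hq, ?_⟩
      intro x hx
      rcases List.mem_cons.1 hx with rfl | hx
      · rfl
      · exact hlev' q hq x hx
    have hend : (v :: t).reverse ≠ [] ∧ (v :: t).reverse.IsChain G.Adj ∧
        ∀ x ∈ (v :: t).reverse, lev x = lev v := by
      have := good (v, t) (by simp)
      refine ⟨by simp, ?_, fun x hx => this.2.2 x (List.mem_reverse.1 hx)⟩
      rw [List.isChain_reverse]
      exact this.2.1.imp fun _ _ h => h.symm
    have hmid : List.Forall₂ (fun s i => s ≠ [] ∧ s.IsChain G.Adj ∧ ∀ x ∈ s, lev x = i)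
        (T.map fun s => s.1 :: s.2) (T.map fun s => lev s.1) := by
      rw [List.forall₂_map_left_iff, List.forall₂_map_right_iff, List.forall₂_same]
      intro s hs
      exact good s (by simp [hs])
    have hfst := good (u, s) (by simp)
    have hpre : List.Forall₂ (fun s i => s ≠ [] ∧ s.IsChain G.Adj ∧ ∀ x ∈ s, lev x = i)
        ((u :: s) :: T.map fun s => s.1 :: s.2) (lev u :: T.map fun s => lev s.1) :=
      List.Forall₂.cons hfst hmid
    have hsuf : List.Forall₂ (fun s i => s ≠ [] ∧ s.IsChain G.Adj ∧ ∀ x ∈ s, lev x = i)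
        [(v :: t).reverse] [lev v] := List.Forall₂.cons hend List.Forall₂.nil
    exact List.rel_append hpre hsuf
  have hLp : (List.flatMap (fun s => s.1 :: s.2) ((u, s) :: (v, t) :: T)).Perm L.flatten := by
    simp only [L, List.map_cons, List.cons_append, List.flatten_cons, List.flatten_append,
      List.flatten_nil, List.append_nil, List.flatMap_def]
    refine List.Perm.cons _ (List.Perm.append_left _ ?_)
    exact List.perm_append_comm.trans ((List.reverse_perm (v :: t)).symm.append_left _)
  have hne : L.flatten ≠ [] := by simp [L]
  have hhead : L.flatten.head hne = u := by simp [L]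
  have hlast : L.flatten.getLast hne = v := by simp [L]
  refine ⟨(Walk.ofSupport L.flatten hne hchain).copy hhead hlast, fun x => ?_⟩
  rw [Walk.support_copy, Walk.support_ofSupport]
  exact List.count_eq_one_of_mem (hLp.nodup_iff.1 hPP.nodup) (hLp.mem_iff.1 (hPP.cover x))

theorem isPathPartition_sigma {ι : Type*} [Fintype ι] {V : ι → Type*} {G : SimpleGraph ι}
    {H : ∀ i, SimpleGraph (V i)} {S : ∀ i, List (V i × List (V i))}
    (hS : ∀ i, (H i).IsPathPartition (S i)) :
    (G.genLexProduct H).IsPathPartition ((Finset.univ : Finset ι).toList.flatMap fun i =>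
      (S i).map fun s => ((⟨i, s.1⟩ : Σ i, V i), s.2.map (Sigma.mk i))) := by
  have key : (List.flatMap (fun s : (Σ i, V i) × List (Σ i, V i) => s.1 :: s.2)
      ((Finset.univ : Finset ι).toList.flatMap fun i =>
      (S i).map fun s => ((⟨i, s.1⟩ : Σ i, V i), s.2.map (Sigma.mk i)))) =
      (Finset.univ : Finset ι).toList.flatMap fun i =>
        ((S i).flatMap fun s => s.1 :: s.2).map (Sigma.mk i) := by
    rw [List.flatMap_assoc]
    congr 1
    funext i
    rw [List.flatMap_map, List.map_flatMap]
    rfl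
  refine ⟨?_, ?_, ?_⟩
  · intro s hs
    obtain ⟨i, -, hs⟩ := List.mem_flatMap.1 hs
    obtain ⟨q, hq, rfl⟩ := List.mem_map.1 hs
    simp only [← List.map_cons]
    rw [List.isChain_map]
    exact ((hS i).chain q hq).imp fun _ _ h => genLexProduct_adj_same.2 h
  · rw [key, List.nodup_flatMap]
    refine ⟨fun i _ => (hS i).nodup.map sigma_mk_injective, ?_⟩
    refine (Finset.nodup_toList _).imp ?_
    intro i j hij x hx hx'
    obtain ⟨a, -, rfl⟩ := List.mem_map.1 hx
    obtain ⟨b, -, hb⟩ := List.mem_map.1 hx'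
    exact hij (congrArg Sigma.fst hb).symm
  · rintro ⟨i, v⟩
    rw [key, List.mem_flatMap]
    exact ⟨i, by simp, List.mem_map_of_mem ((hS i).cover v)⟩

section Product

variable {k n : ℕ} {V : Fin (2 * k + 1) → Type*} [∀ i, Fintype (V i)] [∀ i, DecidableEq (V i)]
  {H : ∀ i, SimpleGraph (V i)}

theorem exists_isHamiltonian_of_sum (hk : 1 ≤ k) (hV : ∀ i, Fintype.card (V i) = n)
    (P : ∀ i, Finset (V i)) (hP : ∀ i T, P i ⊆ T →
      ∃ S, (H i).IsPathPartition S ∧ (S.map Prod.fst).Perm T.toList)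
    {u v : Σ i, V i} (huv : u ≠ v) (hle : u.1 ≤ v.1) (hu : u.2 ∈ P u.1) (hv : v.2 ∈ P v.1)
    (x : ℕ → ℕ) (hx : ∀ j (hj : j < k + 1), x j + (P ⟨2 * j, by omega⟩).card ≤ n)
    (hsum : ∑ j ∈ Finset.range (k + 1), x j + 1 = n + u.1.1 % 2 + v.1.1 % 2)
    (h0 : u.1.1 % 2 + v.1.1 % 2 ≤ x 0) (h0' : u.1.1 = 0 ∨ 1 ≤ x 0)
    (h1 : u.1.1 % 2 + v.1.1 % 2 ≤ x k) (h1' : v.1.1 = 2 * k ∨ 1 ≤ x k) :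
    ∃ p : ((pathGraph (2 * k + 1)).genLexProduct H).Walk u v, p.IsHamiltonian := by
  -- The heads: every vertex on an odd level, `n - x j` vertices on level `2 * j`.
  have hT : ∀ i : Fin (2 * k + 1), ∃ T, P i ⊆ T ∧
      T.card = if i.1 % 2 = 0 then n - x (i.1 / 2) else n := by
    intro i
    refine Finset.exists_superset_card_eq ?_ ?_
    · have hc := Finset.card_le_univ (P i)
      rw [hV] at hc
      split_ifs with h
      · have h2 := hx (i.1 / 2) (by omega)
        have : (⟨2 * (i.1 / 2), by omega⟩ : Fin (2 * k + 1)) = i := Fin.ext (by simp; omega)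
        rw [this] at h2
        omega
      · exact hc
    · rw [hV]
      split_ifs <;> omega
  choose T hPT hTc using hT
  choose S hS hST using fun i => hP i (T i) (hPT i)
  have hPP := isPathPartition_sigma (G := pathGraph (2 * k + 1)) hS
  have hmem : ∀ y : Σ i, V i, y ∈ ((Finset.univ : Finset (Fin (2 * k + 1))).toList.flatMap fun i =>
      (S i).map fun s => ((⟨i, s.1⟩ : Σ i, V i), s.2.map (Sigma.mk i))).map Prod.fst ↔
      y.2 ∈ T y.1 := by
    rintro ⟨i, y⟩
    rw [← Finset.mem_toList, ← (hST i).mem_iff]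
    simp only [List.mem_map, List.mem_flatMap, Finset.mem_toList, Finset.mem_univ, true_and]
    constructor
    · rintro ⟨s, ⟨j, s, hs, rfl⟩, h⟩
      cases h
      exact ⟨s, hs, rfl⟩
    · rintro ⟨s, hs, rfl⟩
      exact ⟨_, ⟨i, s, hs, rfl⟩, rfl⟩
  refine hPP.exists_isHamiltonian (lev := fun y => y.1.1) ?_ ?_ huv ((hmem u).2 (hPT _ hu))
    ((hmem v).2 (hPT _ hv))
    (hasLevelWalk_of_sum k n u.1.1 v.1.1 hk x hle (by omega) hsum h0 h0' h1 h1') ?_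
  · intro y z h
    exact Or.inl (pathGraph_adj.2 (Or.inl h))
  · intro s hs y hy
    obtain ⟨i, -, hs⟩ := List.mem_flatMap.1 hs
    obtain ⟨s, hs, rfl⟩ := List.mem_map.1 hs
    obtain ⟨z, -, rfl⟩ := List.mem_map.1 hy
    rfl
  · intro i
    have hp := (List.perm_ext_iff_of_nodup hPP.nodup_heads
      (Finset.nodup_toList ((Finset.univ.sigma T)))).2 (by
        intro y
        rw [hmem y]
        simp)
    have hp' := hp.map fun y => y.1.1
    rw [List.map_map] at hp'
    refine (hp'.count_eq i).trans ?_
    rw [← Multiset.coe_count, ← Multiset.map_coe, Finset.coe_toList, Multiset.count_map]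
    change ((Finset.univ.sigma T).filter fun y => i = y.1.1).card = _
    split_ifs with hi h2
    · have : ((Finset.univ.sigma T).filter fun y => i = y.1.1) =
          (T ⟨i, by omega⟩).map (Function.Embedding.sigmaMk _) := by
        ext ⟨j, y⟩
        simp only [Finset.mem_filter, Finset.mem_sigma, Finset.mem_univ, true_and,
          Finset.mem_map, Function.Embedding.sigmaMk_apply]
        constructor
        · rintro ⟨hy, rfl⟩
          exact ⟨y, hy, rfl⟩
        · rintro ⟨z, hz, h⟩
          cases h
          exact ⟨hz, rfl⟩
      rw [this, Finset.card_map, hTc, if_pos h2]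
    · have : ((Finset.univ.sigma T).filter fun y => i = y.1.1) =
          (T ⟨i, by omega⟩).map (Function.Embedding.sigmaMk _) := by
        ext ⟨j, y⟩
        simp only [Finset.mem_filter, Finset.mem_sigma, Finset.mem_univ, true_and,
          Finset.mem_map, Function.Embedding.sigmaMk_apply]
        constructor
        · rintro ⟨hy, rfl⟩
          exact ⟨y, hy, rfl⟩
        · rintro ⟨z, hz, h⟩
          cases h
          exact ⟨hz, rfl⟩
      rw [this, Finset.card_map, hTc, if_neg h2]
    · rw [Finset.card_eq_zero, Finset.filter_eq_empty_iff]
      intro y _ h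
      have := y.1.2
      omega

theorem exists_isHamiltonian_of_le_sum (hk : 1 ≤ k) (hV : ∀ i, Fintype.card (V i) = n)
    (P : ∀ i, Finset (V i)) (hP : ∀ i T, P i ⊆ T →
      ∃ S, (H i).IsPathPartition S ∧ (S.map Prod.fst).Perm T.toList)
    {u v : Σ i, V i} (huv : u ≠ v) (hle : u.1 ≤ v.1) (hu : u.2 ∈ P u.1) (hv : v.2 ∈ P v.1)
    (hsum : n + u.1.1 % 2 + v.1.1 % 2 ≤
      ∑ j : Fin (k + 1), (n - (P ⟨2 * j, by omega⟩).card) + 1)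
    (c d : ℕ) (hc : c + (P 0).card ≤ n) (hd : d + (P (Fin.last (2 * k))).card ≤ n)
    (hcd : c + d + 1 ≤ n + u.1.1 % 2 + v.1.1 % 2)
    (h0 : u.1.1 % 2 + v.1.1 % 2 ≤ c) (h0' : u.1.1 = 0 ∨ 1 ≤ c)
    (h1 : u.1.1 % 2 + v.1.1 % 2 ≤ d) (h1' : v.1.1 = 2 * k ∨ 1 ≤ d) :
    ∃ p : ((pathGraph (2 * k + 1)).genLexProduct H).Walk u v, p.IsHamiltonian := by
  let hi : ℕ → ℕ := fun j => if h : j < k + 1 then n - (P ⟨2 * j, by omega⟩).card else 0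
  -- `c` and `d` are reserved for the two end levels, which are distinct since `1 ≤ k`.
  let lo : ℕ → ℕ := fun j => (if j = 0 then c else 0) + (if j = k then d else 0)
  have hlo : ∑ j ∈ Finset.range (k + 1), lo j = c + d := by
    simp [lo, Finset.sum_add_distrib]
  have hhi : ∑ j ∈ Finset.range (k + 1), hi j =
      ∑ j : Fin (k + 1), (n - (P ⟨2 * j, by omega⟩).card) := by
    rw [Finset.sum_range]
    refine Finset.sum_congr rfl fun j _ => ?_
    simp only [hi, dif_pos j.2]
  have hi0 : hi 0 = n - (P 0).card := by simp only [hi, dif_pos (Nat.succ_pos k)]; rfl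
  have hik : hi k = n - (P (Fin.last (2 * k))).card := by
    simp only [hi, dif_pos (Nat.lt_succ_self k)]; rfl
  have hlohi : ∀ j, lo j ≤ hi j := by
    intro j
    by_cases hj0 : j = 0
    · subst hj0
      rw [hi0]
      simp only [lo, if_true]
      rw [if_neg (by omega)]
      omega
    by_cases hjk : j = k
    · subst hjk
      rw [hik]
      simp only [lo, if_true]
      rw [if_neg (by omega)]
      omega
    · simp [lo, hj0, hjk]
  obtain ⟨x, hx, hxs⟩ := exists_sum_eq (Finset.range (k + 1)) lo hi (fun j _ => hlohi j)
    (n + u.1.1 % 2 + v.1.1 % 2 - 1) (by omega) (by omega)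
  have hx0 := (hx 0 (by simp)).1
  have hxk := (hx k (by simp)).1
  have hlo0 : lo 0 = c := by
    simp only [lo, if_true]
    rw [if_neg (by omega)]; rfl
  have hlok : lo k = d := by
    simp only [lo, if_true]
    rw [if_neg (by omega)]; omega
  refine exists_isHamiltonian_of_sum hk hV P hP huv hle hu hv x ?_ (by omega) (by omega)
    (by omega) (by omega) (by omega)
  intro j hj
  have h2 := (hx j (Finset.mem_range.2 hj)).2
  simp only [hi, dif_pos hj] at h2
  have := Finset.card_le_univ (P ⟨2 * j, by omega⟩)
  rw [hV] at this
  omega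

end Product


/-- With at least three vertices the closing edge cannot already be on the path. -/
theorem isHamiltonian_of_adj {X : Type*} [Fintype X] [DecidableEq X] {G : SimpleGraph X} {u v : X}
    (p : G.Walk u v) (hp : p.IsHamiltonian) (h : G.Adj v u) (hX : 3 ≤ Fintype.card X) :
    G.IsHamiltonian := by
  refine fun _ => ⟨v, Walk.cons h p, ?_, ?_⟩
  · rw [Walk.cons_isCycle_iff]
    refine ⟨hp.isPath, fun hmem => ?_⟩
    have hlen := hp.length_eq
    have hpath := hp.isPath
    cases p with
    | nil => exact h.ne rfl
    | cons h' q =>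
      rw [Walk.cons_isPath_iff] at hpath
      rw [Walk.edges_cons, List.mem_cons] at hmem
      rcases hmem with hmem | hmem
      · rcases Sym2.eq_iff.1 hmem with ⟨h1, h2⟩ | ⟨h1, -⟩
        · exact h.ne h1
        · subst h1
          have := Walk.length_eq_zero_iff.2 (Walk.isPath_iff_nil.1 hpath.1)
          rw [Walk.length_cons] at hlen
          omega
      · exact hpath.2 (q.snd_mem_support_of_mem_edges hmem)
  · intro x
    simpa using hp x

theorem IsPathPartition.heads_nonempty {V : Type*} [Nonempty V] {G : SimpleGraph V}
    {S : List (V × List V)} (h : G.IsPathPartition S) {T : Finset V}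
    (hT : (S.map Prod.fst).Perm T.toList) : T.Nonempty := by
  rw [Finset.nonempty_iff_ne_empty]
  rintro rfl
  obtain ⟨v⟩ := ‹Nonempty V›
  have : S = [] := by simpa using hT
  have := h.cover v
  simp_all

end SimpleGraph

/-! ### The three equivalences -/

open SimpleGraph in
theorem theorem2 (k n : ℕ) (hk : 1 ≤ k) (hn : 1 ≤ n)
    (V : Fin (2 * k + 1) → Type*) [∀ i, Fintype (V i)] [∀ i, DecidableEq (V i)]
    (hV : ∀ i, Fintype.card (V i) = n) (H : ∀ i, SimpleGraph (V i)) :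
    (((SimpleGraph.pathGraph (2 * k + 1)).genLexProduct H).IsHamiltonian ↔
      1 ≤ (H 0).maxLinearForest ∧ 1 ≤ (H (Fin.last (2 * k))).maxLinearForest ∧
        n ≤ ∑ i : Fin (k + 1), (H ⟨2 * i, by omega⟩).maxLinearForest) ∧
    (((SimpleGraph.pathGraph (2 * k + 1)).genLexProduct H).IsTraceable ↔
      n - 1 ≤ ∑ i : Fin (k + 1), (H ⟨2 * i, by omega⟩).maxLinearForest) ∧
    (((SimpleGraph.pathGraph (2 * k + 1)).genLexProduct H).IsHamiltonianConnected ↔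
      2 ≤ (H 0).maxLinearForest ∧ 2 ≤ (H (Fin.last (2 * k))).maxLinearForest ∧
        n + 1 ≤ ∑ i : Fin (k + 1), (H ⟨2 * i, by omega⟩).maxLinearForest) := by
  choose Q hQc hQ using fun i => exists_heads (H i)
  simp only [hV] at hQc
  have hne : ∀ i, Nonempty (V i) := fun i => Fintype.card_pos_iff.1 (by rw [hV]; exact hn)
  have hQne : ∀ i, (Q i).Nonempty := by
    intro i
    obtain ⟨S, hS, hST⟩ := hQ i (Q i) subset_rfl
    exact hS.heads_nonempty hST
  have hcard : Fintype.card (Σ i, V i) = (2 * k + 1) * n := by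
    simp [Fintype.card_sigma, hV]
  have hnbr0 : ∀ i : Fin (2 * k + 1), (pathGraph (2 * k + 1)).Adj 0 i → i = ⟨1, by omega⟩ := by
    intro i hi
    rw [pathGraph_adj] at hi
    apply Fin.ext
    simp at hi ⊢
    omega
  have hnbrl : ∀ i : Fin (2 * k + 1), (pathGraph (2 * k + 1)).Adj (Fin.last (2 * k)) i →
      i = ⟨2 * k - 1, by omega⟩ := by
    intro i hi
    rw [pathGraph_adj] at hi
    apply Fin.ext
    simp at hi ⊢
    omega
  have end0 : ∀ {M : ℕ} {g : ℕ → Σ i, V i},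
      ((pathGraph (2 * k + 1)).genLexProduct H).IsHamiltonianSeq M g →
      (if (g 0).1.1 = 1 then 1 else 0) + (if (g M).1.1 = 1 then 1 else 0) + 1 ≤
      2 * (H 0).maxLinearForest +
      (if (g 0).1.1 = 0 then 1 else 0) + (if (g M).1.1 = 0 then 1 else 0) := by
    intro M g hg
    have := hg.le_maxLinearForest_end hV hn 0 ⟨1, by omega⟩ ⟨2, by omega⟩
      (by simp [Fin.ext_iff]) (by simp [Fin.ext_iff]) (by simp [Fin.ext_iff]) hnbr0
    simpa only [Fin.ext_iff, Fin.val_zero] using this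
  have endl : ∀ {M : ℕ} {g : ℕ → Σ i, V i},
      ((pathGraph (2 * k + 1)).genLexProduct H).IsHamiltonianSeq M g →
      (if (g 0).1.1 = 2 * k - 1 then 1 else 0) + (if (g M).1.1 = 2 * k - 1 then 1 else 0) + 1 ≤
      2 * (H (Fin.last (2 * k))).maxLinearForest +
      (if (g 0).1.1 = 2 * k then 1 else 0) + (if (g M).1.1 = 2 * k then 1 else 0) := by
    intro M g hg
    have := hg.le_maxLinearForest_end hV hn (Fin.last (2 * k)) ⟨2 * k - 1, by omega⟩
      ⟨2 * k - 2, by omega⟩ (by simp [Fin.ext_iff]; omega) (by simp [Fin.ext_iff]; omega)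
      (by simp [Fin.ext_iff]; omega) hnbrl
    simpa only [Fin.ext_iff, Fin.val_last] using this
  have hodd : Odd (2 * k - 1) := ⟨k - 1, by omega⟩
  have hsumQ : ∑ i : Fin (k + 1), (H ⟨2 * i, by omega⟩).maxLinearForest ≤
      ∑ j : Fin (k + 1), (n - (Q ⟨2 * j, by omega⟩).card) :=
    Finset.sum_le_sum fun j _ => by have := hQc ⟨2 * j, by omega⟩; omega
  have hQ0 := hQc 0
  have hQl := hQc (Fin.last (2 * k))
  have hQ0' := (hQne 0).card_pos
  have hQl' := (hQne (Fin.last (2 * k))).card_pos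
  refine ⟨⟨?_, ?_⟩, ⟨?_, ?_⟩, ⟨?_, ?_⟩⟩
  · intro hG
    -- `IsHamiltonian` holds by convention on a single vertex, so this case is excluded.
    have hnt : Nontrivial (Σ i, V i) := by
      rw [← Fintype.one_lt_card_iff_nontrivial, hcard]
      nlinarith
    -- The cycle is cut open at a vertex of an odd level next to an end level: one end of the
    -- resulting path is there.
    obtain ⟨v⟩ := hne ⟨1, by omega⟩
    obtain ⟨w⟩ := hne ⟨2 * k - 1, by omega⟩
    obtain ⟨p, hp⟩ := hG.exists_isHamiltonianCycle ⟨_, v⟩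
    obtain ⟨q, hq⟩ := hG.exists_isHamiltonianCycle ⟨_, w⟩
    have hp' := hp.isHamiltonian_tail.isHamiltonianSeq
    have hq' := hq.isHamiltonian_tail.isHamiltonianSeq
    have e1 := end0 hp'
    have e2 := endl hq'
    have e3 := hp'.le_sum_maxLinearForest hV
    simp only [Walk.getVert_length, Walk.getVert_zero, odd_one, if_true] at e1 e2 e3
    refine ⟨?_, ?_, ?_⟩
    · rw [if_neg one_ne_zero] at e1
      split_ifs at e1 <;> omega
    · rw [if_neg (by omega : ¬ 2 * k - 1 = 2 * k)] at e2
      split_ifs at e2 <;> omega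
    · omega
  · rintro ⟨h1, h2, h3⟩
    obtain ⟨u, hu⟩ := hQne 0
    obtain ⟨v⟩ := hne ⟨1, by omega⟩
    -- A path from level `0` to level `1` will be closed to a cycle. Making every odd-level vertex a
    -- head costs nothing, as only even levels enter the sum.
    let P : ∀ i, Finset (V i) := fun i => if i.1 % 2 = 1 then Finset.univ else Q i
    have hPe : ∀ i, i.1 % 2 = 0 → P i = Q i := fun i hi => if_neg (by omega)
    have hQP : ∀ i, Q i ⊆ P i := by
      intro i
      by_cases hi : i.1 % 2 = 1
      · simp [P, hi]
      · rw [hPe i (by omega)]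
    obtain ⟨p, hp⟩ := exists_isHamiltonian_of_le_sum hk hV P
      (fun i T hT => hQ i T ((hQP i).trans hT)) (u := ⟨0, u⟩) (v := ⟨⟨1, by omega⟩, v⟩)
      (by intro h; simpa [Fin.ext_iff] using congrArg Sigma.fst h) (Fin.zero_le _) (hQP _ hu)
      (by simp [P])
      (by
        have : ∀ j : Fin (k + 1), P ⟨2 * j, by omega⟩ = Q ⟨2 * j, by omega⟩ :=
          fun j => hPe _ (by simp)
        simp only [this]
        simp
        omega) 1 1 (by rw [hPe 0 (by simp)]; omega) (by rw [hPe _ (by simp)]; omega)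
      (by simp; omega) (by simp) (by simp) (by simp) (by simp)
    refine isHamiltonian_of_adj p hp (Or.inl (pathGraph_adj.2 (Or.inr ?_))) ?_
    · simp
    · rw [hcard]
      nlinarith
  · rintro ⟨u, v, p, hp⟩
    have := hp.isHamiltonianSeq.le_sum_maxLinearForest hV
    omega
  · intro h
    -- Joining the two end levels through existing heads imposes no condition on `x 0` and `x k`.
    obtain ⟨u, hu⟩ := hQne 0
    obtain ⟨v, hv⟩ := hQne (Fin.last (2 * k))
    obtain ⟨p, hp⟩ := exists_isHamiltonian_of_le_sum hk hV Q hQ (u := ⟨0, u⟩)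
      (v := ⟨Fin.last (2 * k), v⟩)
      (by
        intro h
        have := congrArg Sigma.fst h
        simp [Fin.ext_iff] at this
        omega) (Fin.zero_le _) hu hv
      (by simp; omega) 0 0 (by omega) (by omega) (by simp; omega) (by simp) (by simp) (by simp)
      (by simp)
    exact ⟨_, _, p, hp⟩
  · intro hG
    -- For `n = 1` a path from level `0` to level `1` would force an edge inside the one-vertex
    -- level `0`.
    have hn2 : 2 ≤ n := by
      by_contra hn2
      obtain ⟨u⟩ := hne 0
      obtain ⟨v⟩ := hne ⟨1, by omega⟩
      obtain ⟨p, hp⟩ := hG ⟨_, u⟩ ⟨_, v⟩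
        (by intro h; simpa [Fin.ext_iff] using congrArg Sigma.fst h)
      have e := end0 hp.isHamiltonianSeq
      simp only [Walk.getVert_length, Walk.getVert_zero, if_true] at e
      simp at e
      omega
    have pair : ∀ i, ∃ u v : V i, u ≠ v := fun i => by
      have := Fintype.one_lt_card_iff_nontrivial.1 (by rw [hV i]; omega)
      exact exists_pair_ne (V i)
    -- Both ends in the level next to an end level is the extremal choice.
    obtain ⟨u, v, huv⟩ := pair ⟨1, by omega⟩
    obtain ⟨u', v', huv'⟩ := pair ⟨2 * k - 1, by omega⟩
    obtain ⟨p, hp⟩ := hG ⟨_, u⟩ ⟨_, v⟩ (fun h => huv (sigma_mk_injective h))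
    obtain ⟨q, hq⟩ := hG ⟨_, u'⟩ ⟨_, v'⟩ (fun h => huv' (sigma_mk_injective h))
    have e1 := end0 hp.isHamiltonianSeq
    have e2 := endl hq.isHamiltonianSeq
    have e3 := hp.isHamiltonianSeq.le_sum_maxLinearForest hV
    simp only [Walk.getVert_length, Walk.getVert_zero, odd_one, if_true] at e1 e2 e3
    rw [if_neg one_ne_zero] at e1
    rw [if_neg (by omega : ¬ 2 * k - 1 = 2 * k)] at e2
    exact ⟨by omega, by omega, by omega⟩
  · rintro ⟨h1, h2, h3⟩
    have main : ∀ u v : Σ i, V i, u ≠ v → u.1 ≤ v.1 →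
        ∃ p : ((pathGraph (2 * k + 1)).genLexProduct H).Walk u v, p.IsHamiltonian := by
      intro u v huv hle
      -- `u` and `v` must become heads. Each one on an even level lowers the available sum by at
      -- most one, which by `hr` matches the drop in the sum required.
      let R : ∀ i, Finset (V i) := fun i => Finset.univ.filter fun y => ⟨i, y⟩ = u ∨ ⟨i, y⟩ = v
      let r : Fin (2 * k + 1) → ℕ := fun i =>
        (if u.1 = i then 1 else 0) + (if v.1 = i then 1 else 0)
      have hone : ∀ (w : Σ i, V i) i, (Finset.univ.filter fun y : V i => ⟨i, y⟩ = w).card ≤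
          if w.1 = i then 1 else 0 := by
        intro w i
        split_ifs with h
        · rw [Finset.card_le_one]
          intro y hy z hz
          simp only [Finset.mem_filter, Finset.mem_univ, true_and] at hy hz
          exact sigma_mk_injective (hy.trans hz.symm)
        · rw [Nat.le_zero, Finset.card_eq_zero, Finset.filter_eq_empty_iff]
          intro y _ hy
          exact h (congrArg Sigma.fst hy).symm
      have hR : ∀ i, (R i).card ≤ r i := by
        intro i
        simp only [R, Finset.filter_or]
        exact (Finset.card_union_le _ _).trans (Nat.add_le_add (hone u i) (hone v i))
      have hP : ∀ i, (H i).maxLinearForest ≤ (n - (Q i ∪ R i).card) + r i := by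
        intro i
        have := Finset.card_union_le (Q i) (R i)
        have := hR i
        have := hQc i
        omega
      have hPn : ∀ i, (Q i ∪ R i).card ≤ n := fun i => by
        rw [← hV i]; exact Finset.card_le_univ _
      have hr : ∑ j : Fin (k + 1), r ⟨2 * j, by omega⟩ + u.1.1 % 2 + v.1.1 % 2 = 2 := by
        have hu := sum_even_add_odd u.1
        have hv := sum_even_add_odd v.1
        have hmod : ∀ m : ℕ, (if Odd m then 1 else 0) = m % 2 := by
          intro m
          split_ifs with h
          · exact (Nat.odd_iff.1 h).symm
          · exact (Nat.not_odd_iff.1 h).symm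
        rw [hmod] at hu hv
        simp only [r, Finset.sum_add_distrib]
        omega
      have hs : ∑ i : Fin (k + 1), (H ⟨2 * i, by omega⟩).maxLinearForest ≤
          ∑ j : Fin (k + 1), ((n - (Q ⟨2 * j, by omega⟩ ∪ R ⟨2 * j, by omega⟩).card) +
            r ⟨2 * j, by omega⟩) := Finset.sum_le_sum fun j _ => hP _
      rw [Finset.sum_add_distrib] at hs
      have hP0 := hP 0
      have hPl := hP (Fin.last (2 * k))
      have hPn0 := hPn 0
      have hPnl := hPn (Fin.last (2 * k))
      have hu2 := u.1.2
      have hv2 := v.1.2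
      have hle' : u.1.1 ≤ v.1.1 := hle
      have hr0 : r 0 = (if u.1.1 = 0 then 1 else 0) + (if v.1.1 = 0 then 1 else 0) :=
        congrArg₂ (· + ·) (if_congr Fin.ext_iff rfl rfl) (if_congr Fin.ext_iff rfl rfl)
      have hrl : r (Fin.last (2 * k)) =
          (if u.1.1 = 2 * k then 1 else 0) + (if v.1.1 = 2 * k then 1 else 0) :=
        congrArg₂ (· + ·) (if_congr Fin.ext_iff rfl rfl) (if_congr Fin.ext_iff rfl rfl)
      rw [hr0] at hP0
      rw [hrl] at hPl
      clear hr0 hrl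
      refine exists_isHamiltonian_of_le_sum hk hV (fun i => Q i ∪ R i)
        (fun i T hT => hQ i T (Finset.subset_union_left.trans hT)) huv hle
        (Finset.mem_union_right _ (by simp [R])) (Finset.mem_union_right _ (by simp [R]))
        (by omega)
        -- The least values of `c` and `d` that the level walk allows.
        (if u.1.1 % 2 + v.1.1 % 2 = 0 then (if u.1.1 = 0 then 0 else 1)
          else u.1.1 % 2 + v.1.1 % 2)
        (if u.1.1 % 2 + v.1.1 % 2 = 0 then (if v.1.1 = 2 * k then 0 else 1)
          else u.1.1 % 2 + v.1.1 % 2) ?_ ?_ ?_ ?_ ?_ ?_ ?_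
      · clear hPl
        revert hP0
        split_ifs <;> intro hP0 <;> omega
      · clear hP0
        revert hPl
        split_ifs <;> intro hPl <;> omega
      all_goals clear hP0 hPl; split_ifs <;> omega
    intro u v huv
    rcases le_total u.1 v.1 with h | h
    · exact main u v huv h
    · obtain ⟨p, hp⟩ := main v u huv.symm h
      refine ⟨p.reverse, fun x => ?_⟩
      rw [Walk.support_reverse, List.count_reverse]
      exact hp x
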